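/- All graphs are finite, simple and undirected. A graph $H$ is a reconstruction of a graph $G$ if $V(H)=V(G)$ and $G-v\cong H-v$ for every vertex $v$; $G$ is reconstructible if every reconstruction of $G$ is isomorphic to $G$. A class $\mathcal{C}$ of graphs (closed under isomorphism) is recognizable if, whenever $G$ and $H$ are reconstructions of each other, $G\in\mathcal{C}$ if and only if $H\in\mathcal{C}$. First-order sentences are over the language with equality and one binary relation symbol, interpreted by adjacency; the quantifier rank $qr(\varphi)$ is the maximal nesting depth of quantifiers in $\varphi$. **Theorem.** Let $(G_1,G_2,G_3,\dots)$ be a sequence of graphs with $|V(G_i)|=i$, and let $f\in\mathbb{N}$ be such that every vertex of every $G_i$ has degree at most $f$. Let $\mathcal{C}$ be a recognizable class of graphs with $G_i\in\mathcal{C}$ for every $i\ge 1$. Suppose that there is a first-order sentence $\varphi$ such that for every $i\ge 1$ and every graph $G\in\mathcal{C}$ with $|V(G)|=i$, $$G\models\varphi\iff G\cong G_i .$$ Put $n_\varphi=3^{f^{qr(\varphi)}}+1$ (with $0^0=1$). Then $G_n$ is reconstructible for every $n>n_\varphi$. -/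

import Mathlib

/-- `H` is a reconstruction of `G`: both graphs have the same vertex set, and for every vertex `v`
the vertex-deleted subgraphs `G - v` and `H - v` are isomorphic. -/
def SimpleGraph.IsReconstruction {V : Type*} (H G : SimpleGraph V) : Prop :=
  ∀ v : V, Nonempty (G.induce {v}ᶜ ≃g H.induce {v}ᶜ)

/-- A graph is reconstructible if every reconstruction of it is isomorphic to it. -/
def SimpleGraph.IsReconstructible {V : Type*} (G : SimpleGraph V) : Prop :=
  ∀ H : SimpleGraph V, H.IsReconstruction G → Nonempty (H ≃g G)

/-- A class of finite simple graphs, closed under isomorphism. As in finite model theory, the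
graphs of size `n` are those with vertex set `{0, …, n - 1}`. -/
structure GraphClass where
  /-- the members of size `n` of the class -/
  Mem : ∀ {n : ℕ}, SimpleGraph (Fin n) → Prop
  /-- the class is closed under isomorphism -/
  mem_of_iso : ∀ {n : ℕ} {G H : SimpleGraph (Fin n)}, Nonempty (G ≃g H) → Mem G → Mem H

/-- A class of graphs is recognizable if its characteristic function takes the same value on any
two graphs that are reconstructions of each other. -/
def GraphClass.Recognizable (C : GraphClass) : Prop :=
  ∀ {n : ℕ} (G H : SimpleGraph (Fin n)), H.IsReconstruction G → (C.Mem G ↔ C.Mem H)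

/-- The quantifier rank of a first-order formula: the maximal nesting depth of its quantifiers.
(Formulas are built from `⊥`, atoms, `→` and `∀`; the other connectives and `∃ = ¬∀¬` are
abbreviations, and for them this gives the usual values.) -/
def FirstOrder.Language.BoundedFormula.quantifierRank {L : FirstOrder.Language} {α : Type*} :
    ∀ {n : ℕ}, L.BoundedFormula α n → ℕ
  | _, .falsum => 0
  | _, .equal _ _ => 0
  | _, .rel _ _ => 0
  | _, .imp φ ψ => max φ.quantifierRank ψ.quantifierRank
  | _, .all φ => φ.quantifierRank + 1

/-- The first-order sentence `φ` in the language of graphs (equality and one binary relation symbol,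
interpreted by adjacency) is true in the graph `G`. -/
def SimpleGraph.Satisfies {V : Type*} (G : SimpleGraph V)
    (φ : FirstOrder.Language.graph.Sentence) : Prop :=
  @FirstOrder.Language.Sentence.Realize FirstOrder.Language.graph V G.structure φ

open Set

/-! A reconstruction `H` of `G n` lies in the class by recognizability, so it suffices that `H`
satisfies the sentence because `G n` does. By Hanf locality, a sentence of rank q cannot distinguish
finite graphs in which every rooted ball type of radius `hanfRadius d`, d < q, occurs equally often
(`satisfies_iff_of_sameBallCounts`). By Kelly's lemma, any graph on fewer than n vertices has
equally many embeddings into both graphs (`IsReconstruction.card_embedding_eq`). Sorting embeddings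
of a ball by the image of its centre and inverting a triangular system turns this into equal ball
counts (`IsReconstruction.sameBallCounts`), provided that all balls have fewer than n vertices. The
degree bound, which Kelly's lemma passes on to `H`, and the size of the threshold guarantee this. -/

namespace SimpleGraph

variable {V W U ι κ : Type*} {G : SimpleGraph V} {H : SimpleGraph W} {K : SimpleGraph U}

/-! ### Neighbourhoods of vertex sets -/

/-- The set of vertices at distance at most `k` from the set `A`. -/
def nbhd (G : SimpleGraph V) : ℕ → Set V → Set V
  | 0, A => A
  | k + 1, A => nbhd G k A ∪ {y | ∃ x ∈ nbhd G k A, G.Adj x y}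

theorem nbhd_zero (A : Set V) : G.nbhd 0 A = A := rfl

theorem mem_nbhd_succ {k : ℕ} {A : Set V} {y : V} :
    y ∈ G.nbhd (k + 1) A ↔ y ∈ G.nbhd k A ∨ ∃ x ∈ G.nbhd k A, G.Adj x y := Iff.rfl

theorem nbhd_mono_left {k m : ℕ} (h : k ≤ m) (A : Set V) : G.nbhd k A ⊆ G.nbhd m A := by
  induction h with
  | refl => exact Subset.rfl
  | step _ ih => exact ih.trans subset_union_left

theorem subset_nbhd (k : ℕ) (A : Set V) : A ⊆ G.nbhd k A := nbhd_mono_left (Nat.zero_le k) A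

theorem nbhd_mono {k : ℕ} {A B : Set V} (h : A ⊆ B) : G.nbhd k A ⊆ G.nbhd k B := by
  induction k with
  | zero => exact h
  | succ k ih =>
    rintro y (hy | ⟨x, hx, hxy⟩)
    · exact Or.inl (ih hy)
    · exact Or.inr ⟨x, ih hx, hxy⟩

theorem nbhd_union (k : ℕ) (A B : Set V) : G.nbhd k (A ∪ B) = G.nbhd k A ∪ G.nbhd k B := by
  induction k with
  | zero => rfl
  | succ k ih =>
    ext y
    simp only [mem_nbhd_succ, ih, mem_union]
    grind

theorem nbhd_add (k m : ℕ) (A : Set V) : G.nbhd (k + m) A = G.nbhd k (G.nbhd m A) := by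
  induction k with
  | zero => rw [Nat.zero_add, nbhd_zero]
  | succ k ih =>
    ext y
    rw [Nat.add_right_comm, mem_nbhd_succ, mem_nbhd_succ, ih]

theorem nbhd_empty (k : ℕ) : G.nbhd k ∅ = ∅ := by
  induction k with
  | zero => rfl
  | succ k ih => ext y; simp [mem_nbhd_succ, ih]

theorem nbhd_subset_nbhd_add {k m : ℕ} {A B : Set V} (h : A ⊆ G.nbhd m B) :
    G.nbhd k A ⊆ G.nbhd (k + m) B := by
  rw [nbhd_add]; exact nbhd_mono h

theorem Adj.mem_nbhd_succ {k : ℕ} {A : Set V} {x y : V} (h : G.Adj x y) (hx : x ∈ G.nbhd k A) :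
    y ∈ G.nbhd (k + 1) A := Or.inr ⟨x, hx, h⟩

theorem mem_nbhd_singleton_symm {k : ℕ} {x y : V} (h : y ∈ G.nbhd k {x}) : x ∈ G.nbhd k {y} := by
  induction k generalizing y with
  | zero => exact (mem_singleton_iff.1 h).symm
  | succ k ih =>
    rcases h with h | ⟨z, hz, hzy⟩
    · exact nbhd_mono_left k.le_succ _ (ih h)
    · refine nbhd_subset_nbhd_add (singleton_subset_iff.2 ?_) (ih hz)
      exact hzy.symm.mem_nbhd_succ (k := 0) (mem_singleton y)

/-! ### Local isomorphisms and neighbourhoods of tuples -/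

/-- A partial bijection that preserves adjacency and non-adjacency on its source. -/
def IsLocalIso (G : SimpleGraph V) (H : SimpleGraph W) (e : PartialEquiv V W) : Prop :=
  ∀ x ∈ e.source, ∀ y ∈ e.source, (H.Adj (e x) (e y) ↔ G.Adj x y)

theorem IsLocalIso.symm {e : PartialEquiv V W} (he : IsLocalIso G H e) :
    IsLocalIso H G e.symm := by
  intro x hx y hy
  rw [← he _ (e.map_target hx) _ (e.map_target hy), e.right_inv hx, e.right_inv hy]

theorem IsLocalIso.trans {e : PartialEquiv V W} {e' : PartialEquiv W U} (he : IsLocalIso G H e)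
    (he' : IsLocalIso H K e') : IsLocalIso G K (e.trans e') := by
  intro x hx y hy
  rw [PartialEquiv.trans_source] at hx hy
  rw [PartialEquiv.coe_trans, Function.comp, Function.comp, he' _ hx.2 _ hy.2, he _ hx.1 _ hy.1]

theorem IsLocalIso.restr {e : PartialEquiv V W} (he : IsLocalIso G H e) (s : Set V) :
    IsLocalIso G H (e.restr s) := by
  intro x hx y hy
  rw [PartialEquiv.restr_source] at hx hy
  exact he x hx.1 y hy.1

theorem IsLocalIso.image_nbhd_subset {e : PartialEquiv V W} (he : IsLocalIso G H e) {k : ℕ}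
    {C : Set V} (h : G.nbhd k C ⊆ e.source) : e '' G.nbhd k C ⊆ H.nbhd k (e '' C) := by
  induction k with
  | zero => exact Subset.rfl
  | succ k ih =>
    have ih := ih ((nbhd_mono_left k.le_succ C).trans h)
    rintro _ ⟨y, hy | ⟨x, hx, hxy⟩, rfl⟩
    · exact Or.inl (ih (mem_image_of_mem _ hy))
    · refine Or.inr ⟨e x, ih (mem_image_of_mem _ hx), ?_⟩
      exact (he x (h (Or.inl hx)) y (h (Or.inr ⟨x, hx, hxy⟩))).2 hxy

theorem IsLocalIso.image_nbhd {e : PartialEquiv V W} (he : IsLocalIso G H e) {k : ℕ}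
    {C : Set V} (h : G.nbhd k C ⊆ e.source) (h' : H.nbhd k (e '' C) ⊆ e.target) :
    e '' G.nbhd k C = H.nbhd k (e '' C) := by
  refine (he.image_nbhd_subset h).antisymm fun y hy => ?_
  have hC : C ⊆ e.source := (subset_nbhd k C).trans h
  have := he.symm.image_nbhd_subset h' (mem_image_of_mem _ hy)
  rw [e.symm_image_image_of_subset_source hC] at this
  exact ⟨_, this, e.right_inv (h' hy)⟩

/-- The neighbourhoods of radius `d` of the tuples `a` and `b` are isomorphic, by an isomorphism
that maps `a` to `b`. -/
def NbhdIso (G : SimpleGraph V) (H : SimpleGraph W) (d : ℕ) (a : ι → V) (b : ι → W) : Prop :=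
  ∃ e : PartialEquiv V W, IsLocalIso G H e ∧ e.source = G.nbhd d (range a) ∧
    e.target = H.nbhd d (range b) ∧ ∀ i, e (a i) = b i

/-- The balls of radius `d` around `x` and `y` are isomorphic as rooted graphs. -/
abbrev BallIso (G : SimpleGraph V) (H : SimpleGraph W) (d : ℕ) (x : V) (y : W) : Prop :=
  NbhdIso G H d (fun _ : Unit => x) (fun _ => y)

theorem NbhdIso.refl (G : SimpleGraph V) (d : ℕ) (a : ι → V) : NbhdIso G G d a a :=
  ⟨PartialEquiv.ofSet (G.nbhd d (range a)), fun _ _ _ _ => Iff.rfl, rfl, rfl, fun _ => rfl⟩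

theorem mem_nbhd_range (d : ℕ) (a : ι → V) (i : ι) : a i ∈ G.nbhd d (range a) :=
  subset_nbhd d _ (mem_range_self i)

theorem NbhdIso.symm {d : ℕ} {a : ι → V} {b : ι → W} (h : NbhdIso G H d a b) :
    NbhdIso H G d b a := by
  obtain ⟨e, he, hs, ht, hab⟩ := h
  refine ⟨e.symm, he.symm, ht, hs, fun i => ?_⟩
  rw [← hab i, e.left_inv]
  rw [hs]; exact mem_nbhd_range d a i

theorem NbhdIso.trans {d : ℕ} {a : ι → V} {b : ι → W} {c : ι → U} (h : NbhdIso G H d a b)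
    (h' : NbhdIso H K d b c) : NbhdIso G K d a c := by
  obtain ⟨e, he, hs, ht, hab⟩ := h
  obtain ⟨e', he', hs', ht', hbc⟩ := h'
  refine ⟨e.trans e', he.trans he', ?_, ?_, fun i => ?_⟩
  · rw [PartialEquiv.trans_source, hs', ← ht, inter_eq_left.2, hs]
    exact e.mapsTo
  · rw [PartialEquiv.trans_target, ht, ← hs', inter_eq_left.2, ht']
    exact e'.mapsTo_symm
  · simp [hab, hbc]

theorem IsLocalIso.nbhdIso {e : PartialEquiv V W} (he : IsLocalIso G H e) {d : ℕ} {c : κ → V}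
    (h : G.nbhd d (range c) ⊆ e.source) (h' : H.nbhd d (range fun i => e (c i)) ⊆ e.target) :
    NbhdIso G H d c fun i => e (c i) := by
  have hr : range (fun i => e (c i)) = e '' range c := by rw [← range_comp]; rfl
  refine ⟨e.restr (G.nbhd d (range c)), he.restr _, ?_, ?_, fun i => rfl⟩
  · rw [PartialEquiv.restr_source, inter_eq_right.2 h]
  · rw [hr] at h' ⊢
    rw [← he.image_nbhd h h', ← PartialEquiv.image_source_eq_target, PartialEquiv.restr_source,
      inter_eq_right.2 h, PartialEquiv.restr_coe]

/-! ### Hanf locality by back-and-forth -/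

theorem NbhdIso.snoc_of_mem {k d : ℕ} {a : Fin k → V} {b : Fin k → W} {e : PartialEquiv V W}
    (he : IsLocalIso G H e) (hs : e.source = G.nbhd (3 * d + 1) (range a))
    (ht : e.target = H.nbhd (3 * d + 1) (range b)) (hab : ∀ i, e (a i) = b i) {c : V}
    (hc : c ∈ G.nbhd (2 * d + 1) (range a)) :
    NbhdIso G H d (Fin.snoc a c : Fin (k + 1) → V) (Fin.snoc b (e c) : Fin (k + 1) → W) := by
  have hr : e '' range a = range b := by rw [← range_comp]; congr 1; funext i; exact hab i
  have hle : 2 * d + 1 ≤ 3 * d + 1 := by omega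
  have him : e '' G.nbhd (2 * d + 1) (range a) = H.nbhd (2 * d + 1) (range b) := by
    rw [← hr]
    refine he.image_nbhd ?_ ?_
    · rw [hs]; exact nbhd_mono_left hle _
    · rw [ht, hr]; exact nbhd_mono_left hle _
  have hsn : (Fin.snoc b (e c) : Fin (k + 1) → W) =
      fun i => e ((Fin.snoc a c : Fin (k + 1) → V) i) := by
    funext i
    refine Fin.lastCases ?_ (fun i => ?_) i <;> simp [hab]
  -- The d-ball around a vertex within 2d + 1 of the tuple stays in the domain of `e`, so `e` itself
  -- gives the answer.
  have hd : 3 * d + 1 = d + (2 * d + 1) := by omega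
  have hec : e c ∈ H.nbhd (2 * d + 1) (range b) := him ▸ mem_image_of_mem e hc
  have key : NbhdIso G H d (Fin.snoc a c : Fin (k + 1) → V)
      fun i => e ((Fin.snoc a c : Fin (k + 1) → V) i) := by
    refine he.nbhdIso ?_ ?_
    · rw [hs, hd]
      refine nbhd_subset_nbhd_add ?_
      rw [Fin.range_snoc]
      exact insert_subset hc (subset_nbhd _ _)
    · rw [ht, hd, ← hsn]
      refine nbhd_subset_nbhd_add ?_
      rw [Fin.range_snoc]
      exact insert_subset hec (subset_nbhd _ _)
  rwa [← hsn] at key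

/-- An edge from x to y would give a path from `A` to `c` of length at most d + 1 + d; this fixes
the threshold 2d + 1. -/
theorem not_mem_nbhd_of_far {d : ℕ} {A : Set V} {c x y : V} (hc : c ∉ G.nbhd (2 * d + 1) A)
    (hx : x ∈ G.nbhd d A) (hy : y ∈ G.nbhd d {c}) : x ≠ y ∧ ¬ G.Adj x y := by
  have hy' : y ∉ G.nbhd (d + 1) A := fun h => hc <| by
    have := nbhd_subset_nbhd_add (singleton_subset_iff.2 h) (mem_nbhd_singleton_symm hy)
    rwa [show d + (d + 1) = 2 * d + 1 by omega] at this
  exact ⟨fun h => hy' (h ▸ Or.inl hx), fun h => hy' (h.mem_nbhd_succ hx)⟩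

/-- On both sides the two neighbourhoods are disjoint with no edges between them, so their
isomorphisms can be glued. -/
theorem NbhdIso.snoc_of_far {k d : ℕ} {a : Fin k → V} {b : Fin k → W} (h : NbhdIso G H d a b)
    {c : V} {c' : W} (hcc : BallIso G H d c c') (hc : c ∉ G.nbhd (2 * d + 1) (range a))
    (hc' : c' ∉ H.nbhd (2 * d + 1) (range b)) :
    NbhdIso G H d (Fin.snoc a c : Fin (k + 1) → V) (Fin.snoc b c' : Fin (k + 1) → W) := by
  classical
  obtain ⟨e, he, hs, ht, hab⟩ := h
  obtain ⟨e', he', hs', ht', hab'⟩ := hcc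
  rw [range_const] at hs' ht'
  have hds : Disjoint e.source e'.source := by
    rw [hs, hs', Set.disjoint_left]
    exact fun x hx hx' => (not_mem_nbhd_of_far hc hx hx').1 rfl
  have hdt : Disjoint e.target e'.target := by
    rw [ht, ht', Set.disjoint_left]
    exact fun x hx hx' => (not_mem_nbhd_of_far hc' hx hx').1 rfl
  have h1 : ∀ x ∈ e.source, e.disjointUnion e' hds hdt x = e x := fun x hx => by
    rw [PartialEquiv.disjointUnion_eq_piecewise]; exact piecewise_eq_of_mem _ _ _ hx
  have h2 : ∀ x ∈ e'.source, e.disjointUnion e' hds hdt x = e' x := fun x hx => by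
    rw [PartialEquiv.disjointUnion_eq_piecewise]
    exact piecewise_eq_of_notMem _ _ _ (hds.notMem_of_mem_right hx)
  have hcross : ∀ x ∈ e.source, ∀ y ∈ e'.source, ¬ G.Adj x y ∧ ¬ H.Adj (e x) (e' y) := by
    intro x hx y hy
    refine ⟨(not_mem_nbhd_of_far hc (hs ▸ hx) (hs' ▸ hy)).2,
      (not_mem_nbhd_of_far hc' (ht ▸ e.map_source hx) (ht' ▸ e'.map_source hy)).2⟩
  refine ⟨e.disjointUnion e' hds hdt, ?_, ?_, ?_, ?_⟩
  · rintro x (hx | hx) y (hy | hy)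
    · rw [h1 x hx, h1 y hy, he x hx y hy]
    · rw [h1 x hx, h2 y hy]
      exact iff_of_false (hcross x hx y hy).2 (hcross x hx y hy).1
    · rw [h2 x hx, h1 y hy, G.adj_comm, H.adj_comm]
      exact iff_of_false (hcross y hy x hx).2 (hcross y hy x hx).1
    · rw [h2 x hx, h2 y hy, he' x hx y hy]
  · rw [Fin.range_snoc, ← union_singleton, nbhd_union, ← hs, ← hs']; rfl
  · rw [Fin.range_snoc, ← union_singleton, nbhd_union, ← ht, ← ht']; rfl
  · intro i
    refine Fin.lastCases ?_ (fun i => ?_) i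
    · rw [Fin.snoc_last, Fin.snoc_last, h2, hab' ()]
      rw [hs']; exact subset_nbhd d _ (mem_singleton c)
    · rw [Fin.snoc_castSucc, Fin.snoc_castSucc, h1, hab]
      rw [hs]; exact mem_nbhd_range d a i

/-- For `c` far from `a`, the vertices of its ball type near `b` are images under `e` of such
vertices near `a`. The latter miss `c` itself, so equal counts leave a vertex of this type far from
`b`. -/
theorem NbhdIso.exists_snoc [Finite V] [Finite W] {k d : ℕ} {a : Fin k → V} {b : Fin k → W}
    (h : NbhdIso G H (3 * d + 1) a b) (c : V)
    (hcount : {v | BallIso G G d c v}.ncard = {w | BallIso G H d c w}.ncard) :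
    ∃ c', NbhdIso G H d (Fin.snoc a c : Fin (k + 1) → V) (Fin.snoc b c' : Fin (k + 1) → W) := by
  obtain ⟨e, he, hs, ht, hab⟩ := h
  by_cases hc : c ∈ G.nbhd (2 * d + 1) (range a)
  · exact ⟨e c, NbhdIso.snoc_of_mem he hs ht hab hc⟩
  have hr : e '' range a = range b := by rw [← range_comp]; congr 1; funext i; exact hab i
  have hle : ∀ m ≤ 3 * d + 1, e '' G.nbhd m (range a) = H.nbhd m (range b) := fun m hm => by
    rw [← hr]
    refine he.image_nbhd ?_ ?_
    · rw [hs]; exact nbhd_mono_left hm _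
    · rw [ht, hr]; exact nbhd_mono_left hm _
  have hd : 3 * d + 1 = d + (2 * d + 1) := by omega
  have hB := hle (2 * d + 1) (by omega)
  have hsub : {w | BallIso G H d c w} ∩ H.nbhd (2 * d + 1) (range b) ⊆
      e '' ({v | BallIso G G d c v} ∩ G.nbhd (2 * d + 1) (range a)) := by
    rintro w ⟨hw, hwB⟩
    obtain ⟨x, hx, rfl⟩ := hB.symm ▸ hwB
    refine mem_image_of_mem e ⟨?_, hx⟩
    have : BallIso G H d x (e x) := by
      refine he.nbhdIso (c := fun _ : Unit => x) ?_ ?_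
      · rw [hs, hd, range_const]; exact nbhd_subset_nbhd_add (singleton_subset_iff.2 hx)
      · rw [ht, hd, range_const]; exact nbhd_subset_nbhd_add (singleton_subset_iff.2 hwB)
    exact NbhdIso.trans hw this.symm
  have hlt : ({w | BallIso G H d c w} ∩ H.nbhd (2 * d + 1) (range b)).ncard <
      {w | BallIso G H d c w}.ncard := by
    rw [← hcount]
    refine (ncard_le_ncard hsub (toFinite _)).trans_lt ((ncard_image_le (toFinite _)).trans_lt ?_)
    refine ncard_lt_ncard ⟨inter_subset_left, fun hsub => ?_⟩ (toFinite _)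
    exact hc (hsub (NbhdIso.refl G d _)).2
  obtain ⟨c', hc', hc'B⟩ := exists_mem_notMem_of_ncard_lt_ncard hlt
  refine ⟨c', NbhdIso.snoc_of_far ?_ hc' hc fun h => hc'B ⟨hc', h⟩⟩
  have hfun : b = fun i => e (a i) := funext fun i => (hab i).symm
  rw [hfun]
  refine he.nbhdIso ?_ ?_
  · rw [hs]; exact nbhd_mono_left (by omega) _
  · rw [ht, ← hfun]; exact nbhd_mono_left (by omega) _

/-- The radius of the neighbourhoods that have to be isomorphic when `q` quantifiers remain. -/
def hanfRadius : ℕ → ℕ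
  | 0 => 0
  | q + 1 => 3 * hanfRadius q + 1

/-- Every isomorphism type of balls of radius `d` occurs equally often in `G` and in `H`. -/
def SameBallCounts (G : SimpleGraph V) (H : SimpleGraph W) (d : ℕ) : Prop :=
  (∀ c, {v | BallIso G G d c v}.ncard = {w | BallIso G H d c w}.ncard) ∧
    ∀ c, {w | BallIso H H d c w}.ncard = {v | BallIso H G d c v}.ncard

-- This is the Ehrenfeucht–Fraïssé game: each quantifier extends the tuple by one entry, answered
-- from either side by `NbhdIso.exists_snoc`, while the radius drops from 3d + 1 to d.
open FirstOrder Language in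
theorem NbhdIso.realize_iff [Finite V] [Finite W] {k : ℕ}
    (ψ : Language.graph.BoundedFormula Empty k) (q : ℕ) (hq : ψ.quantifierRank ≤ q)
    (hcount : ∀ d < q, SameBallCounts G H (hanfRadius d))
    (v : Empty → V) (w : Empty → W) (a : Fin k → V) (b : Fin k → W)
    (h : NbhdIso G H (hanfRadius q) a b) :
    @BoundedFormula.Realize _ V G.structure _ _ ψ v a ↔
      @BoundedFormula.Realize _ W H.structure _ _ ψ w b := by
  let := G.structure
  let := H.structure
  have term : ∀ {l : ℕ} (a : Fin l → V) (b : Fin l → W) (t : Language.graph.Term (Empty ⊕ Fin l)),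
      ∃ i, t.realize (Sum.elim v a) = a i ∧ t.realize (Sum.elim w b) = b i := by
    intro l a b t
    match t with
    | .var (.inr i) => exact ⟨i, rfl, rfl⟩
    | .func f _ => exact f.elim
  induction ψ generalizing q with
  | falsum => exact Iff.rfl
  | equal t₁ t₂ =>
    obtain ⟨i, hi, hi'⟩ := term a b t₁
    obtain ⟨j, hj, hj'⟩ := term a b t₂
    obtain ⟨e, he, hs, ht, hab⟩ := h
    change t₁.realize (Sum.elim v a) = t₂.realize (Sum.elim v a) ↔
      t₁.realize (Sum.elim w b) = t₂.realize (Sum.elim w b)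
    rw [hi, hi', hj, hj', ← hab, ← hab]
    refine (e.injOn.eq_iff ?_ ?_).symm <;> rw [hs] <;> exact mem_nbhd_range _ _ _
  | rel R ts =>
    cases R
    obtain ⟨i, hi, hi'⟩ := term a b (ts 0)
    obtain ⟨j, hj, hj'⟩ := term a b (ts 1)
    obtain ⟨e, he, hs, ht, hab⟩ := h
    change G.Adj ((ts 0).realize (Sum.elim v a)) ((ts 1).realize (Sum.elim v a)) ↔
      H.Adj ((ts 0).realize (Sum.elim w b)) ((ts 1).realize (Sum.elim w b))
    rw [hi, hi', hj, hj', ← hab, ← hab]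
    refine (he _ ?_ _ ?_).symm <;> rw [hs] <;> exact mem_nbhd_range _ _ _
  | imp ψ₁ ψ₂ ih₁ ih₂ =>
    rw [BoundedFormula.quantifierRank, max_le_iff] at hq
    exact imp_congr (ih₁ q hq.1 hcount a b h) (ih₂ q hq.2 hcount a b h)
  | all ψ ih =>
    rw [BoundedFormula.quantifierRank] at hq
    obtain ⟨q, rfl⟩ : ∃ p, q = p + 1 := ⟨q - 1, by omega⟩
    have ih := fun a b => ih q (by omega) (fun d hd => hcount d (by omega)) a b
    have hc := hcount q q.lt_succ_self
    constructor
    · intro hall y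
      obtain ⟨x, hx⟩ := NbhdIso.exists_snoc (d := hanfRadius q) h.symm y (hc.2 y)
      exact (ih _ _ hx.symm).1 (hall x)
    · intro hall x
      obtain ⟨y, hy⟩ := NbhdIso.exists_snoc (d := hanfRadius q) h x (hc.1 x)
      exact (ih _ _ hy).2 (hall y)

theorem satisfies_iff_of_sameBallCounts [Finite V] {G H : SimpleGraph V}
    (φ : FirstOrder.Language.graph.Sentence)
    (h : ∀ d < φ.quantifierRank, SameBallCounts G H (hanfRadius d)) :
    G.Satisfies φ ↔ H.Satisfies φ := by
  refine NbhdIso.realize_iff φ _ le_rfl h _ _ _ _ ⟨PartialEquiv.ofSet ∅, ?_, ?_, ?_, ?_⟩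
  · exact fun x hx => hx.elim
  · rw [range_eq_empty, nbhd_empty]; rfl
  · rw [range_eq_empty, nbhd_empty]; rfl
  · exact fun i => i.elim0

/-! ### Kelly's lemma -/

section Kelly

variable [Fintype V] [Fintype U]

/-- Embeddings into a vertex-deleted subgraph are the embeddings that avoid the vertex. -/
def embeddingInduceComplEquiv (F : SimpleGraph U) (G : SimpleGraph V) (w : V) :
    (F ↪g G.induce {w}ᶜ) ≃ {e : F ↪g G // w ∉ range e} where
  toFun e := ⟨(Embedding.induce {w}ᶜ).comp e, by
    rintro ⟨x, hx⟩
    exact (e x).2 hx⟩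
  invFun e :=
    { toFun := fun x => ⟨e.1 x, fun h => e.2 ⟨x, h⟩⟩
      inj' := fun x y h => e.1.injective (congrArg Subtype.val h)
      map_rel_iff' := e.1.map_rel_iff }
  left_inv e := by ext x; rfl
  right_inv e := by ext x; rfl

/-- Double counting: each embedding survives the deletion of exactly the vertices outside its range.
-/
theorem sum_card_embedding_induce_compl (F : SimpleGraph U) (G : SimpleGraph V) :
    ∑ w, Nat.card (F ↪g G.induce {w}ᶜ) =
      Nat.card (F ↪g G) * (Fintype.card V - Fintype.card U) := by
  classical
  have : Finite (F ↪g G) := DFunLike.finite _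
  have := Fintype.ofFinite (F ↪g G)
  have h1 : ∀ w, Nat.card (F ↪g G.induce {w}ᶜ) =
      ∑ e : F ↪g G, if w ∉ range e then 1 else 0 := fun w => by
    rw [Nat.card_congr (embeddingInduceComplEquiv F G w), Nat.card_eq_fintype_card,
      Fintype.card_subtype, Finset.card_filter]
  rw [Finset.sum_congr rfl fun w _ => h1 w, Finset.sum_comm, Nat.card_eq_fintype_card,
    ← smul_eq_mul, ← Finset.card_univ, ← Finset.sum_const]
  refine Finset.sum_congr rfl fun e _ => ?_
  rw [← Finset.card_filter]
  have : (Finset.univ.filter fun w => w ∉ range e) = (Finset.univ.map e.toEmbedding)ᶜ := by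
    ext w; simp
  rw [this, Finset.card_compl, Finset.card_map, Finset.card_univ]

theorem IsReconstruction.card_embedding_eq {G H : SimpleGraph V} (h : H.IsReconstruction G)
    (F : SimpleGraph U) (hF : Fintype.card U < Fintype.card V) :
    Nat.card (F ↪g G) = Nat.card (F ↪g H) := by
  refine Nat.eq_of_mul_eq_mul_right (Nat.sub_pos_of_lt hF) ?_
  rw [← sum_card_embedding_induce_compl, ← sum_card_embedding_induce_compl]
  refine Finset.sum_congr rfl fun w _ => ?_
  obtain ⟨i⟩ := h w
  exact Nat.card_congr
    { toFun := fun e => i.toEmbedding.comp e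
      invFun := fun e => i.symm.toEmbedding.comp e
      left_inv := fun e => by ext x; simp
      right_inv := fun e => by ext x; simp }

end Kelly

/-! ### From embedding counts to ball counts -/

/-- A signed weight on a finite set with an equivalence relation has sum zero on every class if it
is orthogonal to the rows of a matrix that is triangular with respect to a size function. -/
theorem sum_class_eq_zero_of_triangular [Fintype ι] (s : Setoid ι) [DecidableRel s.r] (size : ι → ℕ)
    (w : ι → ℤ) (E : ι → ι → ℤ)
    (hE : ∀ a b c, s.r b c → E a b = E a c) (hself : ∀ a, E a a ≠ 0)
    (htri : ∀ a b, size b ≤ size a → E a b ≠ 0 → s.r a b)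
    (hsum : ∀ a, ∑ b, w b * E a b = 0) (a : ι) :
    ∑ b with s.r a b, w b = 0 := by
  classical
  obtain ⟨N, hN⟩ : ∃ N, ∀ a, size a ≤ N :=
    ⟨Finset.univ.sup size, fun a => Finset.le_sup (Finset.mem_univ a)⟩
  -- Larger sizes come first: by triangularity, row `a` meets, apart from its own class, only
  -- classes of larger size, whose weights already sum to zero.
  induction hm : N - size a using Nat.strong_induction_on generalizing a with
  | _ m ih =>
    subst hm
    have hlarge : ∑ b with ¬ s.r a b, w b * E a b = 0 := by
      rw [← Finset.sum_fiberwise _ (fun b => Quotient.mk s b)]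
      refine Finset.sum_eq_zero fun q _ => ?_
      induction q using Quotient.inductionOn with
      | _ c =>
        by_cases hac : s.r a c
        · refine Finset.sum_eq_zero fun b hb => ?_
          simp only [Finset.mem_filter, Finset.mem_univ, true_and] at hb
          exact absurd (s.trans' hac (s.symm' (Quotient.exact hb.2))) hb.1
        · have hfil : (Finset.univ.filter fun b => ¬ s.r a b).filter
              (fun b => Quotient.mk s b = Quotient.mk s c) = Finset.univ.filter (s.r c) := by
            ext b
            simp only [Finset.mem_filter, Finset.mem_univ, true_and]
            constructor
            · exact fun h => s.symm' (Quotient.exact h.2)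
            · exact fun h => ⟨fun h' => hac (s.trans' h' (s.symm' h)),
                Quotient.sound (s.symm' h)⟩
          rw [hfil]
          have hE' : ∀ b ∈ Finset.univ.filter (s.r c), w b * E a b = w b * E a c := fun b hb => by
            rw [hE a c b (Finset.mem_filter.1 hb).2]
          rw [Finset.sum_congr rfl hE', ← Finset.sum_mul]
          by_cases h0 : E a c = 0
          · rw [h0, mul_zero]
          · have hlt : size a < size c := by
              by_contra hle
              exact hac (htri a c (not_lt.1 hle) h0)
            rw [ih (N - size c) (by have := hN c; omega) c rfl, zero_mul]
    have htotal := hsum a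
    rw [← Finset.sum_filter_add_sum_filter_not _ (s.r a), hlarge, add_zero] at htotal
    have hE' : ∀ b ∈ Finset.univ.filter (s.r a), w b * E a b = w b * E a a := fun b hb => by
      rw [hE a a b (Finset.mem_filter.1 hb).2]
    rw [Finset.sum_congr rfl hE', ← Finset.sum_mul] at htotal
    exact (mul_eq_zero.1 htotal).resolve_right (hself a)

/-- The ball of radius `d` around `v` as an induced subgraph. -/
abbrev ballGraph (G : SimpleGraph V) (d : ℕ) (v : V) : SimpleGraph (G.nbhd d {v}) :=
  G.induce (G.nbhd d {v})

/-- The centre of a ball. -/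
def ballRoot (G : SimpleGraph V) (d : ℕ) (v : V) : G.nbhd d {v} :=
  ⟨v, subset_nbhd d _ (mem_singleton v)⟩

/-- The embeddings of a ball that map the centre to a given vertex. -/
abbrev RootedEmbedding (G : SimpleGraph V) (d : ℕ) (v : V) (H : SimpleGraph W) (w : W) : Type _ :=
  {e : G.ballGraph d v ↪g H // e (G.ballRoot d v) = w}

theorem RootedEmbedding.mem_nbhd {d : ℕ} {v : V} {w : W} (e : RootedEmbedding G d v H w)
    (x : G.nbhd d {v}) : e.1 x ∈ H.nbhd d {w} := by
  obtain ⟨x, hx⟩ := x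
  suffices ∀ k (hk : k ≤ d) x (hx : x ∈ G.nbhd k {v}),
      e.1 ⟨x, nbhd_mono_left hk _ hx⟩ ∈ H.nbhd k {w} from this d le_rfl x hx
  intro k
  induction k with
  | zero =>
    intro _ x hx
    obtain rfl : x = v := hx
    exact e.2
  | succ k ih =>
    rintro hk y (hy | ⟨x, hx, hxy⟩)
    · exact Or.inl (ih (by omega) y hy)
    · exact Or.inr ⟨_, ih (by omega) x hx, e.1.map_rel_iff.2 hxy⟩

/-- A rooted embedding cannot increase the distance to the centre, so its image lies in the ball on
which the isomorphism is defined. Used in both directions, this makes the count depend only on the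
ball type of the target. -/
theorem card_rootedEmbedding_le [Finite V] [Finite U] {d : ℕ} {v : V} {w : W} {u : U}
    (h : BallIso H K d w u) :
    Nat.card (RootedEmbedding G d v H w) ≤ Nat.card (RootedEmbedding G d v K u) := by
  obtain ⟨ε, hε, hs, ht, hab⟩ := h
  rw [range_const] at hs
  have hmem : ∀ (e : RootedEmbedding G d v H w) x, e.1 x ∈ ε.source := fun e x => by
    rw [hs]; exact e.mem_nbhd x
  have : Finite (G.ballGraph d v ↪g K) := DFunLike.finite _
  refine Nat.card_le_card_of_injective (fun e => ⟨
    { toFun := fun x => ε (e.1 x)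
      inj' := fun x y hxy => e.1.injective (ε.injOn (hmem e x) (hmem e y) hxy)
      map_rel_iff' := fun {x y} =>
        (hε _ (hmem e x) _ (hmem e y)).trans e.1.map_rel_iff }, ?_⟩) ?_
  · change ε (e.1 _) = u
    rw [e.2]; exact hab ()
  · intro e e' hee
    ext x
    have := DFunLike.congr_fun (congrArg Subtype.val hee) x
    exact ε.injOn (hmem e x) (hmem e' x) this

/-- An injection into a finite set that is no larger is onto. This is the triangularity of the
system. -/
theorem RootedEmbedding.ballIso [Finite V] [Finite W] {d : ℕ} {v : V} {w : W}
    (e : RootedEmbedding G d v H w) (hcard : (H.nbhd d {w}).ncard ≤ (G.nbhd d {v}).ncard) :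
    BallIso G H d v w := by
  classical
  have : Nonempty V := ⟨v⟩
  let g : V → W := fun x => if hx : x ∈ G.nbhd d {v} then e.1 ⟨x, hx⟩ else w
  have hg : ∀ x (hx : x ∈ G.nbhd d {v}), g x = e.1 ⟨x, hx⟩ := fun x hx => dif_pos hx
  have hmaps : MapsTo g (G.nbhd d {v}) (H.nbhd d {w}) := fun x hx => by
    rw [hg x hx]; exact e.mem_nbhd _
  have hinj : InjOn g (G.nbhd d {v}) := fun x hx y hy hxy => by
    rw [hg x hx, hg y hy] at hxy
    exact congrArg Subtype.val (e.1.injective hxy)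
  have himg : g '' G.nbhd d {v} = H.nbhd d {w} :=
    eq_of_subset_of_ncard_le hmaps.image_subset (by rwa [hinj.ncard_image]) (toFinite _)
  have hbij : BijOn g (G.nbhd d {v}) (H.nbhd d {w}) := ⟨hmaps, hinj, himg.symm.subset⟩
  refine ⟨hbij.toPartialEquiv g _ _, ?_, ?_, ?_, ?_⟩
  · intro x hx y hy
    change H.Adj (g x) (g y) ↔ _
    rw [hg x hx, hg y hy]
    exact e.1.map_rel_iff
  · rw [range_const]; rfl
  · rw [range_const]; rfl
  · intro _
    exact (hg v (G.ballRoot d v).2).trans e.2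

theorem sum_card_rootedEmbedding [Finite V] [Fintype W] (G : SimpleGraph V) (d : ℕ) (v : V)
    (H : SimpleGraph W) :
    ∑ w, Nat.card (RootedEmbedding G d v H w) = Nat.card (G.ballGraph d v ↪g H) := by
  classical
  have : Finite (G.ballGraph d v ↪g H) := DFunLike.finite _
  rw [← Nat.card_congr (Equiv.sigmaFiberEquiv fun e : G.ballGraph d v ↪g H => e (G.ballRoot d v)),
    Nat.card_sigma]

theorem IsReconstruction.sameBallCounts [Fintype V] {G H : SimpleGraph V}
    (h : H.IsReconstruction G) (d : ℕ) (hG : ∀ v, (G.nbhd d {v}).ncard < Fintype.card V)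
    (hH : ∀ v, (H.nbhd d {v}).ncard < Fintype.card V) : SameBallCounts G H d := by
  classical
  -- The system is indexed by the vertices of both graphs together, with weight 1 on `G` and −1 on
  -- `H`: a class has weight zero exactly when its ball type occurs equally often in both.
  let Γ : Bool → SimpleGraph V := fun b => cond b G H
  have hΓ : ∀ b v, ((Γ b).nbhd d {v}).ncard < Fintype.card V := by rintro (_ | _) <;> assumption
  let s : Setoid (Bool × V) :=
    { r := fun p q => BallIso (Γ p.1) (Γ q.1) d p.2 q.2
      iseqv := ⟨fun p => NbhdIso.refl _ _ _, NbhdIso.symm, NbhdIso.trans⟩ }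
  have key := sum_class_eq_zero_of_triangular s (fun p => ((Γ p.1).nbhd d {p.2}).ncard)
    (fun p => cond p.1 1 (-1))
    (fun p q => (Nat.card (RootedEmbedding (Γ p.1) d p.2 (Γ q.1) q.2) : ℤ))
    (fun p q r hqr => congrArg Nat.cast
      ((card_rootedEmbedding_le hqr).antisymm (card_rootedEmbedding_le hqr.symm)))
    (fun p => ?_) (fun p q hpq hne => ?_) (fun p => ?_)
  · have hcount : ∀ b v, {x | BallIso (Γ b) G d v x}.ncard =
        {x | BallIso (Γ b) H d v x}.ncard := fun b v => by
      have := key (b, v)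
      rw [Finset.sum_filter, Fintype.sum_prod_type, Fintype.sum_bool, ← Finset.sum_filter,
        ← Finset.sum_filter] at this
      change ∑ x with BallIso (Γ b) G d v x, (1 : ℤ) +
        ∑ x with BallIso (Γ b) H d v x, (-1 : ℤ) = 0 at this
      rw [Finset.sum_const, Finset.sum_const, nsmul_eq_mul, nsmul_eq_mul] at this
      rw [← ncard_coe_finset, ← ncard_coe_finset, Finset.coe_filter_univ, Finset.coe_filter_univ]
        at this
      omega
    exact ⟨hcount true, fun c => (hcount false c).symm⟩
  · have : Finite ((Γ p.1).ballGraph d p.2 ↪g Γ p.1) := DFunLike.finite _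
    have : Nonempty (RootedEmbedding (Γ p.1) d p.2 (Γ p.1) p.2) := ⟨⟨Embedding.induce _, rfl⟩⟩
    exact_mod_cast Nat.card_pos.ne'
  · have : Nat.card (RootedEmbedding (Γ p.1) d p.2 (Γ q.1) q.2) ≠ 0 := by exact_mod_cast hne
    obtain ⟨⟨e⟩, -⟩ := Nat.card_ne_zero.1 this
    exact e.ballIso hpq
  · rw [Fintype.sum_prod_type, Fintype.sum_bool]
    simp only [cond_true, cond_false, one_mul, neg_one_mul, Finset.sum_neg_distrib]
    rw [← Nat.cast_sum, ← Nat.cast_sum, sum_card_rootedEmbedding, sum_card_rootedEmbedding]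
    have hcard : Fintype.card ((Γ p.1).nbhd d {p.2}) < Fintype.card V := by
      rw [← Nat.card_eq_fintype_card, Nat.card_coe_set_eq]
      exact hΓ p.1 p.2
    have := h.card_embedding_eq ((Γ p.1).ballGraph d p.2) hcard
    rw [show Γ true = G from rfl, show Γ false = H from rfl, this]
    exact add_neg_cancel _

/-! ### Degrees, ball sizes and the threshold -/

section

variable {V : Type*} {G H : SimpleGraph V}

/-- A vertex of `H` with f + 1 neighbours spans with them an induced subgraph on f + 2 vertices,
small enough for Kelly's lemma; a copy in `G` would violate the degree bound. -/
theorem IsReconstruction.ncard_neighborSet_le [Fintype V] (h : H.IsReconstruction G) {f : ℕ}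
    (hf : f + 2 < Fintype.card V) (hG : ∀ v, (G.neighborSet v).ncard ≤ f) (v : V) :
    (H.neighborSet v).ncard ≤ f := by
  classical
  by_contra! hlt
  obtain ⟨t, ht, htc⟩ := exists_subset_card_eq hlt
  have hvt : v ∉ t := fun hv => H.irrefl (ht hv)
  let S : Set V := insert v t
  have hS : Fintype.card S < Fintype.card V := by
    rw [← Nat.card_eq_fintype_card, Nat.card_coe_set_eq, ncard_insert_of_notMem hvt, htc]
    exact hf
  have hcard := h.card_embedding_eq (H.induce S) hS
  have : Finite (H.induce S ↪g H) := DFunLike.finite _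
  have : Nonempty (H.induce S ↪g H) := ⟨Embedding.induce S⟩
  obtain ⟨⟨e⟩, -⟩ := Nat.card_ne_zero.1 (hcard.trans_ne Nat.card_pos.ne')
  let g : t → V := fun x => e ⟨x, mem_insert_of_mem v x.2⟩
  have hg : Function.Injective g := fun x y hxy =>
    Subtype.ext (congrArg (fun z : S => (z : V)) (e.injective hxy))
  have hsub : range g ⊆ G.neighborSet (e ⟨v, mem_insert v t⟩) := by
    rintro _ ⟨x, rfl⟩
    exact e.map_rel_iff.2 (ht x.2)
  have hle := (ncard_le_ncard hsub (toFinite _)).trans (hG _)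
  rw [← image_univ, ncard_image_of_injective _ hg, ncard_univ, Nat.card_coe_set_eq, htc] at hle
  omega

theorem ncard_biUnion_le_mul [Finite V] (s : Set V) (t : V → Set V) {m : ℕ}
    (h : ∀ x ∈ s, (t x).ncard ≤ m) : (⋃ x ∈ s, t x).ncard ≤ s.ncard * m := by
  classical
  have := Fintype.ofFinite V
  have heq : ⋃ x ∈ s, t x = ↑(s.toFinset.biUnion fun x => (t x).toFinset) := by
    ext y; simp
  rw [heq, ncard_coe_finset, ncard_eq_toFinset_card' s]
  refine Finset.card_biUnion_le_card_mul _ _ _ fun x hx => ?_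
  rw [← ncard_eq_toFinset_card']
  exact h x (mem_toFinset.1 hx)

/-- Beyond the first layer, each vertex spends a neighbour on the previous layer, which leaves at
most f − 1 for the next. -/
theorem ncard_nbhd_succ_diff_le [Finite V] {f : ℕ} (hG : ∀ v, (G.neighborSet v).ncard ≤ f)
    (v : V) (k : ℕ) : (G.nbhd (k + 1) {v} \ G.nbhd k {v}).ncard ≤ f * (f - 1) ^ k := by
  induction k with
  | zero =>
    rw [pow_zero, mul_one]
    refine (ncard_le_ncard ?_ (toFinite _)).trans (hG v)
    rintro y ⟨hy | ⟨x, hx, hxy⟩, hyv⟩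
    · exact absurd hy hyv
    · obtain rfl : x = v := hx
      exact hxy
  | succ k ih =>
    have hsub : G.nbhd (k + 1 + 1) {v} \ G.nbhd (k + 1) {v} ⊆
        ⋃ x ∈ G.nbhd (k + 1) {v} \ G.nbhd k {v}, G.neighborSet x \ G.nbhd k {v} := by
      rintro y ⟨hy | ⟨x, hx, hxy⟩, hyk⟩
      · exact absurd hy hyk
      · simp only [mem_iUnion]
        exact ⟨x, ⟨hx, fun hx' => hyk (hxy.mem_nbhd_succ hx')⟩, hxy, fun h => hyk (Or.inl h)⟩
    refine (ncard_le_ncard hsub (toFinite _)).trans ((ncard_biUnion_le_mul _ _ ?_).trans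
      ((Nat.mul_le_mul_right (f - 1) ih).trans_eq (by ring)))
    rintro x ⟨hx | ⟨z, hz, hzx⟩, hxk⟩
    · exact absurd hx hxk
    · have hlt : (G.neighborSet x \ G.nbhd k {v}).ncard < (G.neighborSet x).ncard :=
        ncard_lt_ncard ⟨sdiff_subset, fun h => (h hzx.symm).2 hz⟩ (toFinite _)
      have := hG x
      omega

theorem ncard_nbhd_le [Finite V] {f : ℕ} (hG : ∀ v, (G.neighborSet v).ncard ≤ f) (v : V)
    (k : ℕ) : (G.nbhd k {v}).ncard ≤ 1 + ∑ i ∈ Finset.range k, f * (f - 1) ^ i := by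
  induction k with
  | zero => rw [nbhd_zero, ncard_singleton]; exact Nat.le_add_right 1 _
  | succ k ih =>
    rw [← ncard_sdiff_add_ncard_of_subset (nbhd_mono_left k.le_succ {v}) (toFinite _),
      Finset.sum_range_succ]
    have := ncard_nbhd_succ_diff_le hG v k
    simp only [Nat.succ_eq_add_one]
    omega

theorem two_mul_hanfRadius_add_one (q : ℕ) : 2 * hanfRadius q + 1 = 3 ^ q := by
  induction q with
  | zero => rfl
  | succ q ih => rw [hanfRadius, pow_succ]; omega

theorem one_add_sum_le_succ_pow (f k : ℕ) :
    1 + ∑ i ∈ Finset.range k, f * (f - 1) ^ i ≤ (f + 1) ^ k := by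
  induction k with
  | zero => simp
  | succ k ih =>
    rw [Finset.sum_range_succ, pow_succ, ← add_assoc]
    have := Nat.mul_le_mul_left f (Nat.pow_le_pow_left (show f - 1 ≤ f + 1 by omega) k)
    linarith

/-- Let r be the radius. For f ≥ 3, r ≤ f ^ d and f + 1 ≤ 3 ^ f give (f + 1) ^ r ≤ 3 ^ (f * r) ≤ 3 ^
f ^ q. The estimate r ≤ f ^ d needs f ≥ 3; for f = 0, 1, 2 the left side is at most 1, 2 and 2r + 1
= 3 ^ d. -/
theorem one_add_sum_hanfRadius_le (f : ℕ) {d q : ℕ} (hd : d < q) :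
    1 + ∑ i ∈ Finset.range (hanfRadius d), f * (f - 1) ^ i ≤ 3 ^ f ^ q + 1 := by
  have hR := two_mul_hanfRadius_add_one d
  match f with
  | 0 => simp
  | 1 =>
    have : ∑ i ∈ Finset.range (hanfRadius d), 1 * (1 - 1) ^ i ≤ 1 := by
      simp only [Nat.sub_self, one_mul]
      cases hanfRadius d with
      | zero => simp
      | succ k => simp [Finset.sum_range_succ']
    rw [one_pow]
    omega
  | 2 =>
    have h1 : (3 : ℕ) ^ d ≤ 3 ^ 2 ^ q :=
      Nat.pow_le_pow_right (by norm_num) (hd.le.trans Nat.lt_two_pow_self.le)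
    simp only [Nat.add_one_sub_one, one_pow, Finset.sum_const, Finset.card_range, smul_eq_mul]
    omega
  | f + 3 =>
    refine (one_add_sum_le_succ_pow _ _).trans (Nat.le_succ_of_le ?_)
    refine (Nat.pow_le_pow_left (Nat.succ_le_of_lt
      (Nat.lt_pow_self (n := f + 3) (a := 3) (by norm_num))) _).trans ?_
    rw [← pow_mul]
    refine Nat.pow_le_pow_right (by norm_num) ?_
    have h1 : hanfRadius d ≤ (f + 3) ^ d :=
      le_trans (by omega) (Nat.pow_le_pow_left (show 3 ≤ f + 3 by omega) d)
    calc (f + 3) * hanfRadius d ≤ (f + 3) * (f + 3) ^ d := Nat.mul_le_mul_left _ h1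
      _ = (f + 3) ^ (d + 1) := by ring
      _ ≤ (f + 3) ^ q := Nat.pow_le_pow_right (by omega) hd

theorem IsReconstruction.satisfies_iff [Fintype V] (h : H.IsReconstruction G) {f : ℕ}
    (hG : ∀ v, (G.neighborSet v).ncard ≤ f) (φ : FirstOrder.Language.graph.Sentence)
    (hn : 3 ^ f ^ φ.quantifierRank + 1 < Fintype.card V) : G.Satisfies φ ↔ H.Satisfies φ := by
  refine satisfies_iff_of_sameBallCounts φ fun d hd => ?_
  -- Here `hd` makes the rank positive, so f ≤ f ^ rank; at rank 0 there is no radius to consider.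
  have hf : f + 2 < Fintype.card V := by
    have h1 : f < 3 ^ f := Nat.lt_pow_self (by norm_num)
    have h2 : 3 ^ f ≤ 3 ^ f ^ φ.quantifierRank :=
      Nat.pow_le_pow_right (by norm_num) (Nat.le_self_pow (Nat.ne_zero_of_lt hd) f)
    linarith
  have hsmall : ∀ {K : SimpleGraph V}, (∀ v, (K.neighborSet v).ncard ≤ f) →
      ∀ v, (K.nbhd (hanfRadius d) {v}).ncard < Fintype.card V := fun hK v =>
    ((ncard_nbhd_le hK v _).trans (one_add_sum_hanfRadius_le f hd)).trans_lt hn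
  exact h.sameBallCounts _ (hsmall hG) (hsmall (h.ncard_neighborSet_le hf hG))

end

end SimpleGraph

theorem mainTheorem6
    (G : ∀ i : ℕ, SimpleGraph (Fin i)) [∀ i, DecidableRel (G i).Adj]
    (f : ℕ) (hdeg : ∀ i, 1 ≤ i → ∀ v : Fin i, (G i).degree v ≤ f)
    (C : GraphClass) (hC : C.Recognizable)
    (hmem : ∀ i, 1 ≤ i → C.Mem (G i))
    (φ : FirstOrder.Language.graph.Sentence)
    (hφ : ∀ i, 1 ≤ i → ∀ H : SimpleGraph (Fin i), C.Mem H →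
      (H.Satisfies φ ↔ Nonempty (H ≃g G i))) :
    ∀ n : ℕ, 3 ^ (f ^ φ.quantifierRank) + 1 < n → (G n).IsReconstructible := by
  intro n hn H hH
  have h1 : 1 ≤ n := Nat.zero_lt_of_lt hn
  have hdeg' : ∀ v, ((G n).neighborSet v).ncard ≤ f := fun v => by
    rw [← Nat.card_coe_set_eq, Nat.card_eq_fintype_card, SimpleGraph.card_neighborSet_eq_degree]
    exact hdeg n h1 v
  -- Recognizability puts `H` in the class, where isomorphism with `G n` is expressed by the
  -- sentence and can be moved back to `G n`.
  rw [← hφ n h1 H ((hC _ _ hH).1 (hmem n h1)),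
    ← hH.satisfies_iff hdeg' φ (by rwa [Fintype.card_fin]), hφ n h1 _ (hmem n h1)]
  exact ⟨SimpleGraph.Iso.refl⟩
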